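/- Let $M$ be a smooth finite-dimensional manifold with a smooth (regular) foliation $\mathcal F$, given by a cocycle $\{U_i,f_i,g_{ij}\}$ modelled on a finite-dimensional smooth manifold $N_0$: the $U_i$ form an open cover of $M$, the $f_i\colon U_i\to N_0$ are submersions with connected fibres, and the $g_{ij}$ are local diffeomorphisms of $N_0$ with $g_{ij}\circ f_j=f_i$ on $U_i\cap U_j$. Suppose that $\mathcal F$ is transversely symplectic, and let $\omega$ be a transverse symplectic form: a smooth closed $2$-form on $M$ that is basic ($\iota_X\omega=0$ and $\iota_X d\omega=0$ for $X$ tangent to $\mathcal F$) and of maximal rank (it induces a non-degenerate form on the normal bundle $TM/T\mathcal F$, i.e. $\iota_u\omega=0$ only for $u\in T\mathcal F$). Let $C^\infty(M,\mathcal F)$ and $C^\infty(M,\overline{\mathcal F})$ be the algebras of smooth real functions on $M$ that are constant on the leaves, respectively on the closures of the leaves, of $\mathcal F$. Let $M/\overline{\mathcal F}$ be the quotient of $M$ by the equivalence relation generated by lying in a common leaf closure (the space of leaf closures, when these partition $M$), $\pi\colon M\to M/\overline{\mathcal F}$ the projection, and $C^\infty(M/\overline{\mathcal F})$ the algebra of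 functions $\varphi$ on $M/\overline{\mathcal F}$ for which $\varphi\circ\pi$ is smooth. Then: 1. $C^\infty(M,\mathcal F)=C^\infty(M,\overline{\mathcal F})$, and $\varphi\mapsto\varphi\circ\pi$ is an isomorphism of algebras $C^\infty(M/\overline{\mathcal F})\to C^\infty(M,\mathcal F)$. 2. For every $f\in C^\infty(M,\mathcal F)$ and $x\in M$ there is $u\in T_xM$ with $\iota_u\omega_x=d_xf$, and there is a Poisson algebra structure $\{\cdot,\cdot\}$ on $C^\infty(M,\mathcal F)$ (an $\mathbb R$-bilinear Lie bracket satisfying the Leibniz rule) such that $$\{f,g\}(x)=\omega_x(u,v)\quad\text{whenever } u,v\in T_xM,\ \iota_u\omega_x=d_xf,\ \iota_v\omega_x=d_xg,$$ that is, $\{f,g\}=\omega(X_f,X_g)$. There is a Poisson algebra structure on $C^\infty(M/\overline{\mathcal F})$ for which the isomorphism in 1 is an isomorphism of Poisson algebras. -/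

import Mathlib

open scoped Manifold ContDiff Topology

/-- A Poisson algebra structure on a commutative `R`-algebra `A`: an `R`-bilinear Lie bracket
which is a derivation in its second (hence in each) argument. -/
structure PoissonStructure (R A : Type*) [CommRing R] [CommRing A] [Algebra R A] where
  /-- the bracket `{a, b}` -/
  bracket : A →ₗ[R] A →ₗ[R] A
  bracket_self : ∀ a, bracket a a = 0
  jacobi : ∀ a b c,
    bracket a (bracket b c) + bracket b (bracket c a) + bracket c (bracket a b) = 0
  leibniz : ∀ a b c, bracket a (b * c) = bracket a b * c + b * bracket a c

noncomputable section

namespace FoliatedPoisson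

section Forms

variable {E : Type*} [NormedAddCommGroup E] [NormedSpace ℝ E]
  {M : Type*} [TopologicalSpace M] [ChartedSpace E M] {k : ℕ}

/-- The coordinate expression, in the preferred chart `φ` at `x₀`, of a field `σ` of alternating
`k`-linear forms on the tangent spaces of `M`: the pull-back of `σ` by `φ⁻¹`
(meaningful on the open set `φ.target`). -/
def inChart (σ : ∀ x : M, TangentSpace 𝓘(ℝ, E) x [⋀^Fin k]→L[ℝ] ℝ) (x₀ : M) :
    E → E [⋀^Fin k]→L[ℝ] ℝ := fun y =>
  (σ ((extChartAt 𝓘(ℝ, E) x₀).symm y)).compContinuousLinearMap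
    (mfderiv 𝓘(ℝ, E) 𝓘(ℝ, E) (extChartAt 𝓘(ℝ, E) x₀).symm y)

variable (E M k) in
/-- Smooth differential `k`-forms on the manifold `M`. -/
structure DiffForm where
  /-- the value of the form at a point -/
  toFun : ∀ x : M, TangentSpace 𝓘(ℝ, E) x [⋀^Fin k]→L[ℝ] ℝ
  smooth : ∀ x₀ : M, ContDiffOn ℝ ∞ (inChart toFun x₀) (extChartAt 𝓘(ℝ, E) x₀).target

/-- The value at `x` of the exterior derivative `dσ`, computed in the chart at `x` and
transported back to `T_x M`. -/
def DiffForm.d (σ : DiffForm E M k) (x : M) :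
    TangentSpace 𝓘(ℝ, E) x [⋀^Fin (k + 1)]→L[ℝ] ℝ :=
  (extDeriv (inChart σ.toFun x) (extChartAt 𝓘(ℝ, E) x x)).compContinuousLinearMap
    (mfderiv 𝓘(ℝ, E) 𝓘(ℝ, E) (extChartAt 𝓘(ℝ, E) x) x)

/-- `σ` is closed: `dσ = 0`. -/
def DiffForm.IsClosed (σ : DiffForm E M k) : Prop := ∀ x, σ.d x = 0

/-- The tangent vector `u ∈ T_x M` is the value at `x` of a Hamiltonian vector field of `h`:
`ι_u σ = dh` on `T_x M`. -/
def IsHamiltonianVector (σ : DiffForm E M 2) (h : C^∞⟮𝓘(ℝ, E), M; ℝ⟯) (x : M)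
    (u : TangentSpace 𝓘(ℝ, E) x) : Prop :=
  ∀ w : TangentSpace 𝓘(ℝ, E) x, σ.toFun x ![u, w] = mfderiv 𝓘(ℝ, E) 𝓘(ℝ, ℝ) h x w

end Forms

/-- A smooth foliation of `M` given by a cocycle `{U_i, f_i, g_ij}` modelled on `N₀`:
an open cover `U_i`, submersions `f_i : U_i → N₀` with connected fibres, and local
diffeomorphisms `g_ij` of `N₀`, defined on `f_j(U_i ∩ U_j)`, with `g_ij ∘ f_j = f_i` on
`U_i ∩ U_j`.  (The functions `f_i`, `g_ij` are total; only their values on the indicated sets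
are used.) -/
structure Foliation (E : Type*) [NormedAddCommGroup E] [NormedSpace ℝ E]
    (M : Type*) [TopologicalSpace M] [ChartedSpace E M]
    (E' : Type*) [NormedAddCommGroup E'] [NormedSpace ℝ E']
    (N₀ : Type*) [TopologicalSpace N₀] [ChartedSpace E' N₀] (ι : Type*) where
  U : ι → Set M
  isOpen_U : ∀ i, IsOpen (U i)
  cover : ∀ x, ∃ i, x ∈ U i
  f : ι → M → N₀
  submersion : ∀ i, ∀ x ∈ U i, Manifold.IsSubmersionAt 𝓘(ℝ, E) 𝓘(ℝ, E') ∞ (f i) x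
  connected_fibres : ∀ i y, IsPreconnected (U i ∩ f i ⁻¹' {y})
  g : ι → ι → N₀ → N₀
  g_localDiffeo : ∀ i j,
    IsLocalDiffeomorphOn 𝓘(ℝ, E') 𝓘(ℝ, E') ∞ (g i j) (f j '' (U i ∩ U j))
  g_comp : ∀ i j, ∀ x ∈ U i ∩ U j, g i j (f j x) = f i x

namespace Foliation

variable {E : Type*} [NormedAddCommGroup E] [NormedSpace ℝ E]
  {M : Type*} [TopologicalSpace M] [ChartedSpace E M]
  {E' : Type*} [NormedAddCommGroup E'] [NormedSpace ℝ E']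
  {N₀ : Type*} [TopologicalSpace N₀] [ChartedSpace E' N₀] {ι : Type*}
  (F : Foliation E M E' N₀ ι)

/-- Two points lie on a common plaque, i.e. on a common fibre of some `f_i`. -/
def SamePlaque (x y : M) : Prop := ∃ i, x ∈ F.U i ∧ y ∈ F.U i ∧ F.f i x = F.f i y

/-- The leaf through `x`: the points joined to `x` by a finite chain of plaques. -/
def leaf (x : M) : Set M := {y | Relation.EqvGen F.SamePlaque x y}

/-- The tangent space `T_x 𝓕` of the foliation at `x`: the kernel of `d_x f_i`, for `x ∈ U_i`
(the kernel does not depend on `i`). -/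
def tangent (x : M) : Set (TangentSpace 𝓘(ℝ, E) x) :=
  {u | ∀ i, x ∈ F.U i → mfderiv 𝓘(ℝ, E) 𝓘(ℝ, E') (F.f i) x u = 0}

/-- `σ` is basic: `ι_X σ = 0` and `ι_X dσ = 0` (equivalently `L_X σ = 0`) for every `X`
tangent to the foliation. -/
def IsBasic {k : ℕ} (σ : DiffForm E M (k + 1)) : Prop :=
  ∀ x, ∀ u ∈ F.tangent x,
    (∀ v : Fin k → TangentSpace 𝓘(ℝ, E) x, σ.toFun x (Matrix.vecCons u v) = 0) ∧
    (∀ v : Fin (k + 1) → TangentSpace 𝓘(ℝ, E) x, σ.d x (Matrix.vecCons u v) = 0)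

/-- A 2-form has maximal (transverse) rank if the form it induces on the normal bundle
`TM / T𝓕` is non-degenerate: every vector in its kernel is tangent to the foliation. -/
def HasMaximalRank (σ : DiffForm E M 2) : Prop :=
  ∀ x, ∀ u : TangentSpace 𝓘(ℝ, E) x,
    (∀ v : TangentSpace 𝓘(ℝ, E) x, σ.toFun x ![u, v] = 0) → u ∈ F.tangent x

/-- `σ` is a transverse symplectic form for the foliation:
a basic closed 2-form of maximal rank. -/
structure IsTransverseSymplectic (σ : DiffForm E M 2) : Prop where
  basic : F.IsBasic σ
  closed : σ.IsClosed
  maximalRank : F.HasMaximalRank σ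

/-- `C^∞(M, 𝓕)`: the smooth functions that are constant on the leaves. -/
def basicFunctions : Subalgebra ℝ C^∞⟮𝓘(ℝ, E), M; ℝ⟯ where
  carrier := {h | ∀ x, ∀ y ∈ F.leaf x, h y = h x}
  mul_mem' ha hb x y hy := by
    simp only [ContMDiffMap.coe_mul, Pi.mul_apply, ha x y hy, hb x y hy]
  add_mem' ha hb x y hy := by
    simp only [ContMDiffMap.coe_add, Pi.add_apply, ha x y hy, hb x y hy]
  algebraMap_mem' _ _ _ _ := rfl

/-- `C^∞(M, 𝓕̄)`: the smooth functions that are constant on the closures of the leaves. -/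
def closureBasicFunctions : Subalgebra ℝ C^∞⟮𝓘(ℝ, E), M; ℝ⟯ where
  carrier := {h | ∀ x, ∀ y ∈ closure (F.leaf x), h y = h x}
  mul_mem' ha hb x y hy := by
    simp only [ContMDiffMap.coe_mul, Pi.mul_apply, ha x y hy, hb x y hy]
  add_mem' ha hb x y hy := by
    simp only [ContMDiffMap.coe_add, Pi.add_apply, ha x y hy, hb x y hy]
  algebraMap_mem' _ _ _ _ := rfl

/-- The equivalence relation on `M` generated by lying in a common leaf closure. -/
def leafClosureSetoid : Setoid M := Relation.EqvGen.setoid fun x y => y ∈ closure (F.leaf x)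

/-- When the leaf closures partition `M` (as they do for Riemannian foliations), the equivalence
classes are exactly the leaf closures. -/
theorem leafClosureSetoid_iff
    (h : ∀ x y, y ∈ closure (F.leaf x) → closure (F.leaf y) = closure (F.leaf x)) (x y : M) :
    F.leafClosureSetoid x y ↔ y ∈ closure (F.leaf x) := by
  refine ⟨fun hxy => ?_, fun hy => Relation.EqvGen.rel _ _ hy⟩
  have hself : ∀ z, z ∈ closure (F.leaf z) := fun z =>
    subset_closure (Relation.EqvGen.refl z)
  have key : closure (F.leaf y) = closure (F.leaf x) := by
    induction hxy with
    | rel a b hab => exact h a b hab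
    | refl a => rfl
    | symm a b _ ih => exact ih.symm
    | trans a b c _ _ ih₁ ih₂ => exact ih₂.trans ih₁
  exact key ▸ hself y

/-- The space `M / 𝓕̄` of leaf closures. -/
def LeafClosureSpace : Type _ := Quotient F.leafClosureSetoid

/-- The projection `M → M / 𝓕̄`. -/
def proj (x : M) : F.LeafClosureSpace := Quotient.mk F.leafClosureSetoid x

/-- `C^∞(M / 𝓕̄)`: the functions on `M / 𝓕̄` whose pull-back to `M` is smooth. -/
def leafClosureSpaceFunctions : Subalgebra ℝ (F.LeafClosureSpace → ℝ) where
  carrier := {φ | ContMDiff 𝓘(ℝ, E) 𝓘(ℝ, ℝ) ∞ fun x => φ (F.proj x)}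
  mul_mem' ha hb := ContMDiff.mul ha hb
  add_mem' ha hb := ContMDiff.add ha hb
  algebraMap_mem' _ := contMDiff_const

end Foliation

end FoliatedPoisson

end

/-! A smooth function is continuous, so its level sets are closed: constancy on leaves passes to
leaf closures and then to the classes they generate. This gives the first part.

For the bracket, `ω_x` has kernel exactly `T_x𝓕`, and `dh` vanishes there when `h` is basic.
Skew-symmetry and finite dimension then give `u` with `ι_u ω = dh`, unique up to `T_x𝓕`, so `{f, g}
= ω(X_f, X_g) = -dg(X_f)` does not depend on the choices. In a chart `ω` becomes a field `B` of skew
forms of constant rank, since the kernels are those of differentials of submersions onto `N₀`. Hence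
every Hamiltonian vector at a point extends to a smooth local Hamiltonian field
(`exists_contDiffAt_apply_eq`), and the bracket is smooth.

The Jacobi identity is the usual cyclic computation with `dω = 0`; it survives degeneracy because it
uses only the equations `B X = dh` near the point (`cyclic_sum_fderiv_eq_zero`). It holds for
arbitrary Hamiltonian vectors at the point, so it also shows that the bracket is basic: a vector `u`
tangent to `𝓕` is Hamiltonian for the function `0`, and Jacobi for `0, f, g` reduces to `d{f, g}(u)
= 0`. Connectedness of the plaques turns this into constancy on leaves. -/

/-! ### Linear algebra of degenerate skew forms -/

section LinearAlgebra

variable {V : Type*} [AddCommGroup V] [Module ℝ V] [FiniteDimensional ℝ V]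

/-- A linear form which vanishes on the kernel of a skew-symmetric bilinear form is in the range
of that form. -/
theorem LinearMap.exists_apply_eq_of_skew (B : V →ₗ[ℝ] V →ₗ[ℝ] ℝ) (hB : ∀ v w, B v w = -B w v)
    (l : V →ₗ[ℝ] ℝ) (hl : ∀ v, B v = 0 → l v = 0) : ∃ u, B u = l := by
  have hmem : l ∈ LinearMap.range B.dualMap := by
    rw [LinearMap.range_dualMap_eq_dualAnnihilator_ker, Submodule.mem_dualAnnihilator]
    exact fun v hv => hl v hv
  obtain ⟨η, hη⟩ := hmem
  obtain ⟨v, rfl⟩ := (Module.evalEquiv ℝ V).surjective η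
  -- Duality yields `l w = B w v`; skew-symmetry rewrites this as `B (-v) w`.
  refine ⟨-v, ?_⟩
  ext w
  rw [← hη]
  simp [hB v w]

end LinearAlgebra

/-! ### Local Hamiltonian fields and the Jacobi identity in a vector space -/

section LocalCalculus

variable {E : Type*} [NormedAddCommGroup E] [NormedSpace ℝ E]

/-- Smooth local solvability of `B y (X y) = l y`, for a parametrised complement of the kernel of
`B p`. -/
theorem exists_contDiffAt_apply_eq_of_isCompl [FiniteDimensional ℝ E] {n : WithTop ℕ∞}
    {W : Type*} [NormedAddCommGroup W] [NormedSpace ℝ W] [FiniteDimensional ℝ W] {j : W →L[ℝ] E}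
    (hj : Function.Injective j) {B : E → E →L[ℝ] E →L[ℝ] ℝ} {l : E → E →L[ℝ] ℝ} {p : E}
    (hW : IsCompl (B p).ker j.range)
    (hB : ContDiffAt ℝ n B p) (hl : ContDiffAt ℝ n l p) (hskew : ∀ y v w, B y v w = -B y w v)
    (hrank : ∀ᶠ y in 𝓝 p, Module.finrank ℝ (B p).ker ≤ Module.finrank ℝ (B y).ker)
    (hker : ∀ᶠ y in 𝓝 p, ∀ v, B y v = 0 → l y v = 0) {u : E} (hu : B p u = l p) :
    ∃ X : E → E, ContDiffAt ℝ n X p ∧ X p = u ∧ ∀ᶠ y in 𝓝 p, B y (X y) = l y := by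
  let r : (E →L[ℝ] ℝ) →L[ℝ] (W →L[ℝ] ℝ) := ContinuousLinearMap.precomp ℝ j
  let R : (E →L[ℝ] E →L[ℝ] ℝ) →L[ℝ] (W →L[ℝ] W →L[ℝ] ℝ) :=
    ContinuousLinearMap.precomp (W →L[ℝ] ℝ) j ∘L ContinuousLinearMap.postcomp E r
  have hR : ∀ b v w, R b v w = b (j v) (j w) := fun _ _ _ => rfl
  have hr : ∀ a w, r a w = a (j w) := fun _ _ => rfl
  -- Restricted to a complement of its kernel, `B p` is non-degenerate; invertibility of `R (B y)`
  -- then persists for `y` near `p`.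
  have hinj : Function.Injective (R (B p)) := by
    rw [injective_iff_map_eq_zero]
    intro w hw
    have hwk : j w ∈ (B p).ker := by
      rw [LinearMap.mem_ker]
      ext v
      obtain ⟨a, ha, _, ⟨b, rfl⟩, rfl⟩ := Submodule.mem_sup.1
        (show v ∈ (B p).ker ⊔ j.range by rw [hW.sup_eq_top]; trivial)
      have h1 : B p (j w) a = 0 := by
        rw [hskew, show B p a = 0 from ha]; simp
      have h2 : B p (j w) (j b) = 0 := by
        rw [← hR, hw]; rfl
      simpa [h1] using h2
    exact hj (by simpa using Submodule.disjoint_def.1 hW.disjoint _ hwk ⟨w, rfl⟩)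
  have hdim : Module.finrank ℝ W = Module.finrank ℝ (W →L[ℝ] ℝ) := by
    rw [← (LinearMap.toContinuousLinearMap (𝕜 := ℝ) (E := W) (F' := ℝ)).finrank_eq]
    exact (Subspace.dual_finrank_eq (K := ℝ) (V := W)).symm
  let e : W ≃L[ℝ] (W →L[ℝ] ℝ) :=
    (LinearEquiv.ofInjectiveOfFinrankEq (R (B p)).toLinearMap hinj hdim).toContinuousLinearEquiv
  have he : (e : W →L[ℝ] W →L[ℝ] ℝ) = R (B p) := by ext; rfl
  have hRB : ContDiffAt ℝ n (fun y => R (B y)) p := by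
    have h : ContDiff ℝ n R := ContinuousLinearMap.contDiff _
    exact ContDiffAt.comp (F := E →L[ℝ] E →L[ℝ] ℝ) (G := W →L[ℝ] W →L[ℝ] ℝ) p h.contDiffAt hB
  -- The constant field `u` is corrected inside `W` so that the equation holds when tested on `W`.
  -- The correction vanishes at `p` because `B p u = l p`.
  refine ⟨fun y => u + j ((R (B y)).inverse (r (l y - B y u))), ?_, ?_, ?_⟩
  · have h1 : ContDiffAt ℝ n (fun y => (R (B y)).inverse) p := by
      have := contDiffAt_map_inverse (n := n) e
      rw [he] at this
      exact this.comp p hRB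
    have h2 : ContDiffAt ℝ n (fun y => r (l y - B y u)) p :=
      r.contDiff.contDiffAt.comp p (hl.sub (hB.clm_apply contDiffAt_const))
    exact contDiffAt_const.add (j.contDiff.contDiffAt.comp p (h1.clm_apply h2))
  · simp [hu]
  · have hinv : ∀ᶠ y in 𝓝 p, R (B y) ∈ Set.range
        (ContinuousLinearEquiv.toContinuousLinearMap : (W ≃L[ℝ] (W →L[ℝ] ℝ)) → _) := by
      have := e.nhds
      rw [he] at this
      exact hRB.continuousAt this
    filter_upwards [hinv, hrank, hker] with y ⟨ey, hey⟩ hy hky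
    set w : W := (R (B y)).inverse (r (l y - B y u)) with hw
    have hw' : R (B y) w = r (l y - B y u) := by
      rw [hw, ← hey, ContinuousLinearMap.inverse_equiv]
      exact ey.apply_symm_apply _
    have hdisj : j.range ⊓ (B y).ker = ⊥ := by
      rw [eq_bot_iff]
      rintro _ ⟨⟨v, rfl⟩, hvk⟩
      have hz : R (B y) v = 0 := by
        ext w'
        rw [hR, show B y (j v) = 0 from hvk]; rfl
      rw [← hey] at hz
      simp [ey.map_eq_zero_iff.1 hz]
    -- The rank hypothesis enters here: `W` meets `(B y).ker` trivially, and that kernel has not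
    -- shrunk. The equation thus needs testing only on `W`, where it holds by construction, and on
    -- the kernel, where both sides vanish.
    have hsup : j.range ⊔ (B y).ker = ⊤ := by
      apply Submodule.eq_top_of_finrank_eq
      have h1 := Submodule.finrank_sup_add_finrank_inf_eq j.range (B y).ker
      rw [hdisj, finrank_bot] at h1
      have h2 := Submodule.finrank_add_eq_of_isCompl hW
      have h3 := Submodule.finrank_le (j.range ⊔ (B y).ker)
      omega
    ext v
    obtain ⟨_, ⟨a, rfl⟩, b, hb, rfl⟩ := Submodule.mem_sup.1
      (show v ∈ j.range ⊔ (B y).ker by rw [hsup]; trivial)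
    have h1 := congrArg (fun q => q a) hw'
    simp only [hR, hr, sub_apply] at h1
    have hb' : B y b = 0 := hb
    have h2 : ∀ v, B y v b = 0 := fun v => by rw [hskew, hb']; simp
    simp only [map_add, add_apply, h2, hky b hb']
    have h3 : B y (j w) (j a) = l y (j a) - B y u (j a) := h1
    change B y u (j a) + B y (j w) (j a) + (0 + 0) = l y (j a) + 0
    rw [h3]
    ring

/-- If `B` is a smooth field of skew-symmetric bilinear forms of constant rank near `p` and `l` a
smooth field of linear forms vanishing on the kernels of `B`, then every solution `u` of
`B p u = l p` extends to a smooth field of solutions near `p`. -/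
theorem exists_contDiffAt_apply_eq [FiniteDimensional ℝ E] {n : WithTop ℕ∞}
    {B : E → E →L[ℝ] E →L[ℝ] ℝ}
    {l : E → E →L[ℝ] ℝ} {p : E} (hB : ContDiffAt ℝ n B p) (hl : ContDiffAt ℝ n l p)
    (hskew : ∀ y v w, B y v w = -B y w v)
    (hrank : ∀ᶠ y in 𝓝 p, Module.finrank ℝ (B p).ker ≤ Module.finrank ℝ (B y).ker)
    (hker : ∀ᶠ y in 𝓝 p, ∀ v, B y v = 0 → l y v = 0) {u : E} (hu : B p u = l p) :
    ∃ X : E → E, ContDiffAt ℝ n X p ∧ X p = u ∧ ∀ᶠ y in 𝓝 p, B y (X y) = l y := by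
  obtain ⟨W, hW⟩ := (B p).ker.exists_isCompl
  refine exists_contDiffAt_apply_eq_of_isCompl (j := W.subtypeL) W.injective_subtype ?_ hB hl hskew
    hrank hker hu
  simpa using hW

/-- The Jacobi identity at a point `p` for a closed, possibly degenerate, field of
skew-symmetric bilinear forms. -/
theorem cyclic_sum_fderiv_eq_zero {B : E → E →L[ℝ] E →L[ℝ] ℝ} {p : E}
    (hB : DifferentiableAt ℝ B p) (hskew : ∀ y v w, B y v w = -B y w v)
    (hclosed : ∀ a b c, fderiv ℝ B p a b c + fderiv ℝ B p b c a + fderiv ℝ B p c a b = 0)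
    {f g h : E → ℝ} (hf : ContDiffAt ℝ 2 f p) (hg : ContDiffAt ℝ 2 g p)
    (hh : ContDiffAt ℝ 2 h p) {X Y Z : E → E} (hX : DifferentiableAt ℝ X p)
    (hY : DifferentiableAt ℝ Y p) (hZ : DifferentiableAt ℝ Z p)
    (hXf : ∀ᶠ y in 𝓝 p, B y (X y) = fderiv ℝ f y)
    (hYg : ∀ᶠ y in 𝓝 p, B y (Y y) = fderiv ℝ g y)
    (hZh : ∀ᶠ y in 𝓝 p, B y (Z y) = fderiv ℝ h y) :
    fderiv ℝ (fun y => B y (Y y) (Z y)) p (X p) + fderiv ℝ (fun y => B y (Z y) (X y)) p (Y p) +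
      fderiv ℝ (fun y => B y (X y) (Y y)) p (Z p) = 0 := by
  have hskew' : ∀ a v w, fderiv ℝ B p a v w = -fderiv ℝ B p a w v := by
    intro a v w
    have key : ∀ v w, fderiv ℝ (fun y => B y v w) p a = fderiv ℝ B p a v w := by
      intro v w
      have := (hB.hasFDerivAt.clm_apply (hasFDerivAt_const v p)).clm_apply (hasFDerivAt_const w p)
      rw [this.fderiv]; simp
    rw [← key, ← key, ← neg_apply, ← fderiv_fun_neg]
    congr 2
    ext y
    exact hskew y v w
  -- Differentiating `B T = dk` trades the derivative of `T`, which is not determined when `B` is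
  -- degenerate, for the Hessian of `k` and the derivative of `B`.
  have deriv_ham : ∀ {k : E → ℝ} {T : E → E}, DifferentiableAt ℝ T p →
      (∀ᶠ y in 𝓝 p, B y (T y) = fderiv ℝ k y) → ∀ a b,
      B p (fderiv ℝ T p a) b = fderiv ℝ (fderiv ℝ k) p a b - fderiv ℝ B p a (T p) b := by
    intro k T hT hTk a b
    have h1 := hB.hasFDerivAt.clm_apply hT.hasFDerivAt
    have h2 : fderiv ℝ (fun y => B y (T y)) p = fderiv ℝ (fderiv ℝ k) p :=
      Filter.EventuallyEq.fderiv_eq hTk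
    rw [h1.fderiv] at h2
    rw [← h2]
    simp
  have expand : ∀ {S T : E → E}, DifferentiableAt ℝ S p → DifferentiableAt ℝ T p → ∀ a,
      fderiv ℝ (fun y => B y (S y) (T y)) p a = fderiv ℝ B p a (S p) (T p) +
        B p (fderiv ℝ S p a) (T p) - B p (fderiv ℝ T p a) (S p) := by
    intro S T hS hT a
    have h1 := (hB.hasFDerivAt.clm_apply hS.hasFDerivAt).clm_apply hT.hasFDerivAt
    rw [h1.fderiv, hskew p (fderiv ℝ T p a) (S p)]
    simp
    ring
  have symm : ∀ {k : E → ℝ}, ContDiffAt ℝ 2 k p → ∀ a b,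
      fderiv ℝ (fderiv ℝ k) p a b = fderiv ℝ (fderiv ℝ k) p b a := fun hk a b =>
    (hk.isSymmSndFDerivAt (by simp)).eq a b
  -- The Hessians cancel in pairs by symmetry; what remains is minus the cyclic sum of derivatives
  -- of `B`.
  rw [expand hY hZ, expand hZ hX, expand hX hY, deriv_ham hX hXf, deriv_ham hX hXf,
    deriv_ham hY hYg, deriv_ham hY hYg, deriv_ham hZ hZh, deriv_ham hZ hZh,
    symm hf (Y p), symm hg (X p), symm hh (X p), hskew' (X p) (Z p), hskew' (Y p) (X p),
    hskew' (Z p) (Y p)]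
  linear_combination -hclosed (X p) (Y p) (Z p)

end LocalCalculus

/-! ### Alternating 2-forms as bilinear forms -/

section AlternatingTwo

variable (E : Type*) [NormedAddCommGroup E] [NormedSpace ℝ E]

/-- A continuous alternating 2-form as a continuous bilinear form. -/
noncomputable def ContinuousAlternatingMap.toBilinCLM :
    (E [⋀^Fin 2]→L[ℝ] ℝ) →L[ℝ] E →L[ℝ] E →L[ℝ] ℝ :=
  (ContinuousLinearMap.compL ℝ E (E [×1]→L[ℝ] ℝ) (E →L[ℝ] ℝ)
      ((continuousMultilinearCurryFin1 ℝ E ℝ).toContinuousLinearEquiv.toContinuousLinearMap)) ∘L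
    ((continuousMultilinearCurryLeftEquiv ℝ (fun _ : Fin 2 => E)
      ℝ).toContinuousLinearEquiv.toContinuousLinearMap ∘L
      ContinuousAlternatingMap.toContinuousMultilinearMapCLM ℝ)

variable {E}

@[simp]
theorem ContinuousAlternatingMap.toBilinCLM_apply (η : E [⋀^Fin 2]→L[ℝ] ℝ) (v w : E) :
    ContinuousAlternatingMap.toBilinCLM E η v w = η ![v, w] := by
  change η _ = η _
  congr 1
  ext i
  fin_cases i <;> rfl

theorem ContinuousAlternatingMap.apply_swap_two {V : Type*} [AddCommGroup V] [Module ℝ V]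
    [TopologicalSpace V] (η : V [⋀^Fin 2]→L[ℝ] ℝ) (v w : V) : η ![v, w] = -η ![w, v] := by
  have h := η.toAlternatingMap.map_swap ![w, v] (i := 0) (j := 1) (by decide)
  have h2 : ![w, v] ∘ Equiv.swap (0 : Fin 2) 1 = ![v, w] := by
    ext i
    fin_cases i <;> simp
  rw [h2] at h
  exact h

/-- The minus sign of the middle term of the alternating sum is absorbed by swapping `a` and `c`. -/
theorem extDeriv_two_apply {η : E → E [⋀^Fin 2]→L[ℝ] ℝ} {p : E} (hη : DifferentiableAt ℝ η p)
    (a b c : E) : extDeriv η p ![a, b, c] =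
      fderiv ℝ (fun y => ContinuousAlternatingMap.toBilinCLM E (η y)) p a b c +
      fderiv ℝ (fun y => ContinuousAlternatingMap.toBilinCLM E (η y)) p b c a +
      fderiv ℝ (fun y => ContinuousAlternatingMap.toBilinCLM E (η y)) p c a b := by
  have key : fderiv ℝ (fun y => ContinuousAlternatingMap.toBilinCLM E (η y)) p =
      ContinuousAlternatingMap.toBilinCLM E ∘L fderiv ℝ η p := by
    have h : HasFDerivAt (ContinuousAlternatingMap.toBilinCLM E)
      (ContinuousAlternatingMap.toBilinCLM E) (η p) := ContinuousLinearMap.hasFDerivAt _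
    exact (HasFDerivAt.comp (F := E [⋀^Fin 2]→L[ℝ] ℝ) (G := E →L[ℝ] E →L[ℝ] ℝ) p h
      hη.hasFDerivAt).fderiv
  rw [key, extDeriv, ContinuousAlternatingMap.alternatizeUncurryFin_apply, Fin.sum_univ_three]
  have h0 : Fin.removeNth 0 ![a, b, c] = ![b, c] := by ext i; fin_cases i <;> rfl
  have h1 : Fin.removeNth 1 ![a, b, c] = ![a, c] := by ext i; fin_cases i <;> rfl
  have h2 : Fin.removeNth 2 ![a, b, c] = ![a, b] := by ext i; fin_cases i <;> rfl
  rw [h0, h1, h2]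
  simp [ContinuousAlternatingMap.apply_swap_two _ a c]

end AlternatingTwo

/-! ### Submersions and functions along their fibres -/

section Submersion

variable {E : Type*} [NormedAddCommGroup E] [NormedSpace ℝ E]
  {M : Type*} [TopologicalSpace M] [ChartedSpace E M]
  {E' : Type*} [NormedAddCommGroup E'] [NormedSpace ℝ E']
  {N : Type*} [TopologicalSpace N] [ChartedSpace E' N]

theorem OpenPartialHomeomorph.mdifferentiable_of_mem_maximalAtlas [IsManifold 𝓘(ℝ, E) ∞ M]
    {φ : OpenPartialHomeomorph M E} (hφ : φ ∈ IsManifold.maximalAtlas 𝓘(ℝ, E) ∞ M) :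
    φ.MDifferentiable 𝓘(ℝ, E) 𝓘(ℝ, E) :=
  ⟨(contMDiffOn_of_mem_maximalAtlas hφ).mdifferentiableOn (by simp),
    (contMDiffOn_symm_of_mem_maximalAtlas hφ).mdifferentiableOn (by simp)⟩

/-- The separate base point `y` allows composition where the two points agree only propositionally,
as for `φ.symm (φ m)` and `m`. -/
theorem HasMFDerivAt.comp_of_eq {F : Type*} [NormedAddCommGroup F] [NormedSpace ℝ F] {P : Type*}
    [TopologicalSpace P] [ChartedSpace F P] {f : M → N} {k : N → P} {x : M} {y : N}
    {A : E' →L[ℝ] F} {B : E →L[ℝ] E'} (hk : HasMFDerivAt 𝓘(ℝ, E') 𝓘(ℝ, F) k y A)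
    (hf : HasMFDerivAt 𝓘(ℝ, E) 𝓘(ℝ, E') f x B) (hy : f x = y) :
    HasMFDerivAt 𝓘(ℝ, E) 𝓘(ℝ, F) (k ∘ f) x (A ∘L B) := by
  subst hy
  exact hk.comp x hf

/-- A presentation of `f` on the domain of a chart `φ` as a surjective linear map `L`. -/
structure LinearPresentation (f : M → N) (φ : OpenPartialHomeomorph M E)
    (ψ : OpenPartialHomeomorph N E') (L : E →L[ℝ] E') : Prop where
  surj : Function.Surjective L
  mdiff : φ.MDifferentiable 𝓘(ℝ, E) 𝓘(ℝ, E)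
  mdiff_cod : ψ.MDifferentiable 𝓘(ℝ, E') 𝓘(ℝ, E')
  mapsTo : ∀ m ∈ φ.source, f m ∈ ψ.source
  apply_eq : ∀ m ∈ φ.source, ψ (f m) = L (φ m)

theorem Manifold.IsSubmersionAt.exists_linearPresentation [IsManifold 𝓘(ℝ, E) ∞ M]
    [IsManifold 𝓘(ℝ, E') ∞ N] {f : M → N} {m : M}
    (hf : Manifold.IsSubmersionAt 𝓘(ℝ, E) 𝓘(ℝ, E') ∞ f m) :
    ∃ (φ : OpenPartialHomeomorph M E) (ψ : OpenPartialHomeomorph N E') (L : E →L[ℝ] E'),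
      m ∈ φ.source ∧ LinearPresentation f φ ψ L := by
  refine ⟨hf.domChart, hf.codChart, ContinuousLinearMap.fst ℝ E' hf.complement ∘L hf.equiv,
    hf.mem_domChart_source, ?_,
    OpenPartialHomeomorph.mdifferentiable_of_mem_maximalAtlas hf.domChart_mem_maximalAtlas,
    OpenPartialHomeomorph.mdifferentiable_of_mem_maximalAtlas hf.codChart_mem_maximalAtlas,
    fun x hx => hf.source_subset_preimage_source hx, fun x hx => ?_⟩
  · exact Prod.fst_surjective.comp hf.equiv.surjective
  · have h := hf.writtenInCharts
      (show hf.domChart x ∈ (hf.domChart.extend 𝓘(ℝ, E)).target by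
        simpa using hf.domChart.map_source hx)
    simpa [hf.domChart.left_inv hx] using h

namespace LinearPresentation

variable {f : M → N} {φ : OpenPartialHomeomorph M E} {ψ : OpenPartialHomeomorph N E'}
  {L : E →L[ℝ] E'} (h : LinearPresentation f φ ψ L) {m : M}
include h

theorem eq_iff {m' : M} (hm : m ∈ φ.source) (hm' : m' ∈ φ.source) :
    f m' = f m ↔ L (φ m') = L (φ m) := by
  rw [← h.apply_eq m hm, ← h.apply_eq m' hm']
  exact ⟨fun e => by rw [e], fun e => ψ.injOn (h.mapsTo _ hm') (h.mapsTo _ hm) e⟩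

theorem mfderiv_eq (hm : m ∈ φ.source) :
    mfderiv 𝓘(ℝ, E) 𝓘(ℝ, E') f m = (mfderiv 𝓘(ℝ, E') 𝓘(ℝ, E') ψ.symm (L (φ m))).comp
      (L.comp (mfderiv 𝓘(ℝ, E) 𝓘(ℝ, E) φ m)) := by
  have htarget : L (φ m) ∈ ψ.target := h.apply_eq m hm ▸ ψ.map_source (h.mapsTo m hm)
  have h1 := (h.mdiff.mdifferentiableAt hm).hasMFDerivAt
  have h2 : HasMFDerivAt 𝓘(ℝ, E) 𝓘(ℝ, E') L (φ m) L := L.hasMFDerivAt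
  have h3 := (h.mdiff_cod.mdifferentiableAt_symm htarget).hasMFDerivAt
  refine ((h3.comp m (h2.comp m h1)).congr_of_eventuallyEq ?_).mfderiv
  filter_upwards [φ.open_source.mem_nhds hm] with x hx
  simp [← h.apply_eq x hx, ψ.left_inv (h.mapsTo x hx)]

theorem mfderiv_apply_eq_zero_iff (hm : m ∈ φ.source) (u : TangentSpace 𝓘(ℝ, E) m) :
    mfderiv 𝓘(ℝ, E) 𝓘(ℝ, E') f m u = 0 ↔ L (mfderiv 𝓘(ℝ, E) 𝓘(ℝ, E) φ m u) = 0 := by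
  have htarget : L (φ m) ∈ ψ.target := h.apply_eq m hm ▸ ψ.map_source (h.mapsTo m hm)
  rw [h.mfderiv_eq hm]
  exact map_eq_zero_iff _ (h.mdiff_cod.symm.mfderiv_injective htarget)

theorem mfderiv_surjective (hm : m ∈ φ.source) :
    Function.Surjective (mfderiv 𝓘(ℝ, E) 𝓘(ℝ, E') f m) := by
  have htarget : L (φ m) ∈ ψ.target := h.apply_eq m hm ▸ ψ.map_source (h.mapsTo m hm)
  rw [h.mfderiv_eq hm]
  exact (h.mdiff_cod.symm.mfderiv_surjective htarget).comp
    (h.surj.comp (h.mdiff.mfderiv_surjective hm))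

end LinearPresentation

variable [IsManifold 𝓘(ℝ, E) ∞ M] [IsManifold 𝓘(ℝ, E') ∞ N] {f : M → N} {m : M}

theorem Manifold.IsSubmersionAt.mfderiv_surjective
    (hf : Manifold.IsSubmersionAt 𝓘(ℝ, E) 𝓘(ℝ, E') ∞ f m) :
    Function.Surjective (mfderiv 𝓘(ℝ, E) 𝓘(ℝ, E') f m) := by
  obtain ⟨φ, ψ, L, hm, h⟩ := hf.exists_linearPresentation
  exact h.mfderiv_surjective hm

/-- A function which is locally constant on a fibre of a submersion has zero derivative along it. -/
theorem Manifold.IsSubmersionAt.mfderiv_apply_eq_zero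
    (hf : Manifold.IsSubmersionAt 𝓘(ℝ, E) 𝓘(ℝ, E') ∞ f m)
    {F : Type*} [NormedAddCommGroup F] [NormedSpace ℝ F] {P : Type*} [TopologicalSpace P]
    [ChartedSpace F P] {k : M → P} (hk : MDifferentiableAt 𝓘(ℝ, E) 𝓘(ℝ, F) k m)
    (hconst : ∀ᶠ x in 𝓝 m, f x = f m → k x = k m) {u : TangentSpace 𝓘(ℝ, E) m}
    (hu : mfderiv 𝓘(ℝ, E) 𝓘(ℝ, E') f m u = 0) : mfderiv 𝓘(ℝ, E) 𝓘(ℝ, F) k m u = 0 := by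
  obtain ⟨φ, ψ, L, hm, h⟩ := hf.exists_linearPresentation
  rw [h.mfderiv_apply_eq_zero_iff hm] at hu
  set b : E := mfderiv 𝓘(ℝ, E) 𝓘(ℝ, E) φ m u with hb
  let A : E →L[ℝ] E := mfderiv 𝓘(ℝ, E) 𝓘(ℝ, E) φ.symm (φ m)
  have hA : HasMFDerivAt 𝓘(ℝ, E) 𝓘(ℝ, E) φ.symm (φ m) A :=
    (h.mdiff.mdifferentiableAt_symm (φ.map_source hm)).hasMFDerivAt
  have hAb : A b = u := congrArg (fun T => T u) (h.mdiff.symm_comp_deriv hm)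
  -- The line lies in a fibre of `L` because `L b = 0`; its image under `φ.symm` is a curve in the
  -- fibre of `f` with velocity `u`, along which `k` is constant.
  have hline : HasFDerivAt (fun t : ℝ => φ m + t • b) (ContinuousLinearMap.toSpanSingleton ℝ b)
      0 := by
    have := ((hasDerivAt_id (0 : ℝ)).smul_const b).const_add (φ m)
    rwa [one_smul] at this
  have h0 : φ m + (0 : ℝ) • b = φ m := by simp
  have hγ : HasMFDerivAt 𝓘(ℝ, ℝ) 𝓘(ℝ, E) (φ.symm ∘ fun t : ℝ => φ m + t • b) 0
      (A ∘L ContinuousLinearMap.toSpanSingleton ℝ b) :=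
    HasMFDerivAt.comp_of_eq hA hline.hasMFDerivAt h0
  have hγ0 : (φ.symm ∘ fun t : ℝ => φ m + t • b) 0 = m := by simp [φ.left_inv hm]
  have hcomp := HasMFDerivAt.comp_of_eq hk.hasMFDerivAt hγ hγ0
  have hev : k ∘ (φ.symm ∘ fun t : ℝ => φ m + t • b) =ᶠ[𝓝 0] fun _ => k m := by
    have hcont : Filter.Tendsto (φ.symm ∘ fun t : ℝ => φ m + t • b) (𝓝 0) (𝓝 m) := by
      have := hγ.continuousAt
      rwa [ContinuousAt, hγ0] at this
    have hline' : Filter.Tendsto (fun t : ℝ => φ m + t • b) (𝓝 0) (𝓝 (φ m)) := by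
      have := hline.continuousAt
      rwa [ContinuousAt, h0] at this
    filter_upwards [hcont hconst, hcont (φ.open_source.mem_nhds hm),
      hline' (φ.open_target.mem_nhds (φ.map_source hm))] with t ht ht' htt
    refine ht ((h.eq_iff hm ht').2 ?_)
    have htt' : φ m + t • b ∈ φ.target := htt
    simp [φ.right_inv htt', hu]
  have hz := (hcomp.congr_of_eventuallyEq hev.symm).mfderiv
  rw [mfderiv_const] at hz
  have hz1 : (0 : F) = mfderiv 𝓘(ℝ, E) 𝓘(ℝ, F) k m (A ((1 : ℝ) • b)) :=
    congrArg (fun T : ℝ →L[ℝ] F => T (1 : ℝ)) hz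
  rw [one_smul, hAb] at hz1
  exact hz1.symm

/-- A function whose derivative vanishes on the kernels of the differential of a submersion is
locally constant on its fibres. -/
theorem Manifold.IsSubmersionAt.eventually_eq_of_mfderiv_eq_zero
    (hf : Manifold.IsSubmersionAt 𝓘(ℝ, E) 𝓘(ℝ, E') ∞ f m) {k : M → ℝ}
    (hk : ∀ᶠ x in 𝓝 m, MDifferentiableAt 𝓘(ℝ, E) 𝓘(ℝ, ℝ) k x)
    (hker : ∀ᶠ x in 𝓝 m, ∀ u : TangentSpace 𝓘(ℝ, E) x,
      mfderiv 𝓘(ℝ, E) 𝓘(ℝ, E') f x u = 0 → mfderiv 𝓘(ℝ, E) 𝓘(ℝ, ℝ) k x u = 0) :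
    ∀ᶠ x in 𝓝 m, f x = f m → k x = k m := by
  obtain ⟨φ, ψ, L, hm, h⟩ := hf.exists_linearPresentation
  have htend : Filter.Tendsto φ.symm (𝓝 (φ m)) (𝓝 m) := by
    have := φ.continuousAt_symm (φ.map_source hm)
    rwa [ContinuousAt, φ.left_inv hm] at this
  obtain ⟨r, hr, hball⟩ := Metric.eventually_nhds_iff_ball.1
    ((htend.eventually (hk.and hker)).and (φ.open_target.mem_nhds (φ.map_source hm)))
  have hcont : Filter.Tendsto φ (𝓝 m) (𝓝 (φ m)) := φ.continuousAt hm
  filter_upwards [hcont (Metric.ball_mem_nhds _ hr), φ.open_source.mem_nhds hm] with x hxr hx hfx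
  rw [h.eq_iff hm hx] at hfx
  -- The chart segment from `m` to `x` has direction in the kernel of `L`, so `k` has zero
  -- derivative along it.
  let c : ℝ → E := fun t => φ m + t • (φ x - φ m)
  have hc : ∀ t ∈ Set.Icc (0 : ℝ) 1, c t ∈ Metric.ball (φ m) r := fun t ht => by
    have := (convex_ball (φ m) r).add_smul_sub_mem (Metric.mem_ball_self hr) hxr ht
    exact this
  have hderiv : ∀ t ∈ Set.Icc (0 : ℝ) 1, HasDerivAt (fun t => k (φ.symm (c t))) 0 t := by
    intro t ht
    obtain ⟨⟨hkd, hkk⟩, htar⟩ := hball _ (hc t ht)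
    have h1 := hkd.hasMFDerivAt.comp (c t) (h.mdiff.mdifferentiableAt_symm htar).hasMFDerivAt
    have h2 : HasDerivAt c (φ x - φ m) t := by
      have := ((hasDerivAt_id t).smul_const (φ x - φ m)).const_add (φ m)
      rwa [one_smul] at this
    have h3 : HasDerivAt (fun t => k (φ.symm (c t))) (mfderiv 𝓘(ℝ, E) 𝓘(ℝ, ℝ) k (φ.symm (c t))
        (mfderiv 𝓘(ℝ, E) 𝓘(ℝ, E) φ.symm (c t) (φ x - φ m))) t :=
      h1.hasFDerivAt.comp_hasDerivAt t h2
    rwa [hkk] at h3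
    rw [h.mfderiv_apply_eq_zero_iff (φ.map_target htar)]
    have h4 := h.mdiff.symm.symm_comp_deriv htar
    have h5 : mfderiv 𝓘(ℝ, E) 𝓘(ℝ, E) φ (φ.symm (c t))
        (mfderiv 𝓘(ℝ, E) 𝓘(ℝ, E) φ.symm (c t) (φ x - φ m)) = (φ x - φ m : E) :=
      congrArg (fun T => T (φ x - φ m)) h4
    rw [h5, map_sub, hfx, sub_self]
  have hfin := constant_of_has_deriv_right_zero (f := fun t => k (φ.symm (c t))) (a := 0) (b := 1)
    (fun t ht => (hderiv t ht).continuousAt.continuousWithinAt)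
    (fun t ht => (hderiv t ⟨ht.1, ht.2.le⟩).hasDerivWithinAt) 1 (by simp)
  simpa [c, φ.left_inv hm, φ.left_inv hx] using hfin

end Submersion

noncomputable section

namespace FoliatedPoisson

/-! ### Forms and Hamiltonian vectors in charts -/

section Chart

variable {E : Type*} [NormedAddCommGroup E] [NormedSpace ℝ E]
  {M : Type*} [TopologicalSpace M] [ChartedSpace E M] [IsManifold 𝓘(ℝ, E) ∞ M]

theorem mdifferentiableAt_extChartAt_symm (x₀ : M) {y : E}
    (hy : y ∈ (extChartAt 𝓘(ℝ, E) x₀).target) :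
    MDifferentiableAt 𝓘(ℝ, E) 𝓘(ℝ, E) (extChartAt 𝓘(ℝ, E) x₀).symm y := by
  have : IsManifold 𝓘(ℝ, E) 1 M := IsManifold.of_le (n := ∞) (by simp)
  have := mdifferentiableWithinAt_extChartAt_symm hy
  rwa [ModelWithCorners.range_eq_univ, mdifferentiableWithinAt_univ] at this

theorem bijective_mfderiv_extChartAt_symm (x₀ : M) {y : E}
    (hy : y ∈ (extChartAt 𝓘(ℝ, E) x₀).target) :
    Function.Bijective (mfderiv 𝓘(ℝ, E) 𝓘(ℝ, E) (extChartAt 𝓘(ℝ, E) x₀).symm y) := by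
  have : IsManifold 𝓘(ℝ, E) 1 M := IsManifold.of_le (n := ∞) (by simp)
  have := isInvertible_mfderivWithin_extChartAt_symm hy
  rw [ModelWithCorners.range_eq_univ, mfderivWithin_univ] at this
  exact this.bijective

theorem surjective_mfderiv_extChartAt (x : M) :
    Function.Surjective (mfderiv 𝓘(ℝ, E) 𝓘(ℝ, E) (extChartAt 𝓘(ℝ, E) x) x) := by
  have : IsManifold 𝓘(ℝ, E) 1 M := IsManifold.of_le (n := ∞) (by simp)
  exact (isInvertible_mfderiv_extChartAt (mem_extChartAt_source x)).bijective.2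

/-- The coordinate expression of a 2-form, as a field of bilinear forms. -/
def chartBilin (σ : DiffForm E M 2) (x₀ : M) (y : E) : E →L[ℝ] E →L[ℝ] ℝ :=
  ContinuousAlternatingMap.toBilinCLM E (inChart σ.toFun x₀ y)

variable (σ : DiffForm E M 2)

omit [IsManifold 𝓘(ℝ, E) ∞ M] in
theorem chartBilin_apply (x₀ : M) (y v w : E) : chartBilin σ x₀ y v w =
    σ.toFun ((extChartAt 𝓘(ℝ, E) x₀).symm y)
      ![mfderiv 𝓘(ℝ, E) 𝓘(ℝ, E) (extChartAt 𝓘(ℝ, E) x₀).symm y v,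
        mfderiv 𝓘(ℝ, E) 𝓘(ℝ, E) (extChartAt 𝓘(ℝ, E) x₀).symm y w] := by
  rw [chartBilin, ContinuousAlternatingMap.toBilinCLM_apply]
  refine congrArg (σ.toFun ((extChartAt 𝓘(ℝ, E) x₀).symm y)) ?_
  ext i
  fin_cases i <;> rfl

omit [IsManifold 𝓘(ℝ, E) ∞ M] in
theorem chartBilin_skew (x₀ : M) (y v w : E) :
    chartBilin σ x₀ y v w = -chartBilin σ x₀ y w v := by
  rw [chartBilin, ContinuousAlternatingMap.toBilinCLM_apply,
    ContinuousAlternatingMap.toBilinCLM_apply]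
  exact ContinuousAlternatingMap.apply_swap_two _ v w

omit [IsManifold 𝓘(ℝ, E) ∞ M] in
theorem contDiffAt_inChart (x₀ : M) {y : E} (hy : y ∈ (extChartAt 𝓘(ℝ, E) x₀).target) :
    ContDiffAt ℝ ∞ (inChart σ.toFun x₀) y :=
  (σ.smooth x₀).contDiffAt ((isOpen_extChartAt_target x₀).mem_nhds hy)

omit [IsManifold 𝓘(ℝ, E) ∞ M] in
theorem contDiffAt_chartBilin (x₀ : M) {y : E} (hy : y ∈ (extChartAt 𝓘(ℝ, E) x₀).target) :
    ContDiffAt ℝ ∞ (chartBilin σ x₀) y := by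
  have h : ContDiff ℝ ∞ (ContinuousAlternatingMap.toBilinCLM E) := ContinuousLinearMap.contDiff _
  exact ContDiffAt.comp (F := E [⋀^Fin 2]→L[ℝ] ℝ) (G := E →L[ℝ] E →L[ℝ] ℝ) y h.contDiffAt
    (contDiffAt_inChart σ x₀ hy)

/-- The cyclic identity expressing closedness, at the centre of a preferred chart. -/
theorem DiffForm.IsClosed.cyclic {σ : DiffForm E M 2} (hσ : σ.IsClosed) (x : M) (a b c : E) :
    fderiv ℝ (chartBilin σ x) (extChartAt 𝓘(ℝ, E) x x) a b c +
      fderiv ℝ (chartBilin σ x) (extChartAt 𝓘(ℝ, E) x x) b c a +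
      fderiv ℝ (chartBilin σ x) (extChartAt 𝓘(ℝ, E) x x) c a b = 0 := by
  have hs := surjective_mfderiv_extChartAt (E := E) x
  obtain ⟨a', ha⟩ := hs a
  obtain ⟨b', hb⟩ := hs b
  obtain ⟨c', hc⟩ := hs c
  have hd : DifferentiableAt ℝ (inChart σ.toFun x) (extChartAt 𝓘(ℝ, E) x x) :=
    (contDiffAt_inChart σ x (mem_extChartAt_target x)).differentiableAt (by simp)
  have h0 := congrArg (fun q => q ![a', b', c']) (hσ x)
  rw [DiffForm.d] at h0
  change extDeriv (inChart σ.toFun x) (extChartAt 𝓘(ℝ, E) x x)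
    (mfderiv 𝓘(ℝ, E) 𝓘(ℝ, E) (extChartAt 𝓘(ℝ, E) x) x ∘ ![a', b', c']) = 0 at h0
  have h1 : mfderiv 𝓘(ℝ, E) 𝓘(ℝ, E) (extChartAt 𝓘(ℝ, E) x) x ∘ ![a', b', c'] = ![a, b, c] := by
    rw [← ha, ← hb, ← hc]
    ext i
    fin_cases i <;> rfl
  have h2 : extDeriv (inChart σ.toFun x) (extChartAt 𝓘(ℝ, E) x x) ![a, b, c] = 0 :=
    (congrArg (extDeriv (inChart σ.toFun x) (extChartAt 𝓘(ℝ, E) x x)) h1).symm.trans h0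
  rwa [extDeriv_two_apply hd] at h2

variable (h : C^∞⟮𝓘(ℝ, E), M; ℝ⟯)

theorem fderiv_comp_extChartAt_symm (x₀ : M) {k : M → ℝ} {y : E}
    (hy : y ∈ (extChartAt 𝓘(ℝ, E) x₀).target)
    (hk : MDifferentiableAt 𝓘(ℝ, E) 𝓘(ℝ, ℝ) k ((extChartAt 𝓘(ℝ, E) x₀).symm y)) (v : E) :
    fderiv ℝ (k ∘ (extChartAt 𝓘(ℝ, E) x₀).symm) y v =
      mfderiv 𝓘(ℝ, E) 𝓘(ℝ, ℝ) k ((extChartAt 𝓘(ℝ, E) x₀).symm y)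
        (mfderiv 𝓘(ℝ, E) 𝓘(ℝ, E) (extChartAt 𝓘(ℝ, E) x₀).symm y v) := by
  have h1 := HasMFDerivAt.comp_of_eq hk.hasMFDerivAt
    (mdifferentiableAt_extChartAt_symm x₀ hy).hasMFDerivAt rfl
  have h2 : HasFDerivAt (𝕜 := ℝ) (E := E) (F := ℝ) (k ∘ (extChartAt 𝓘(ℝ, E) x₀).symm) _ y :=
    h1.hasFDerivAt
  rw [h2.fderiv]
  rfl

theorem contDiffAt_comp_extChartAt_symm (x₀ : M) {y : E}
    (hy : y ∈ (extChartAt 𝓘(ℝ, E) x₀).target) :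
    ContDiffAt ℝ ∞ (h ∘ (extChartAt 𝓘(ℝ, E) x₀).symm) y := by
  have h1 := (contMDiffOn_extChartAt_symm (I := 𝓘(ℝ, E)) (n := ∞) x₀).contMDiffAt
    ((isOpen_extChartAt_target x₀).mem_nhds hy)
  exact (h.contMDiff.contMDiffAt.comp y h1).contDiffAt

omit [IsManifold 𝓘(ℝ, E) ∞ M] in
theorem mdifferentiableAt_smooth (x : M) : MDifferentiableAt 𝓘(ℝ, E) 𝓘(ℝ, ℝ) h x :=
  h.contMDiff.mdifferentiableAt (by simp)

theorem isHamiltonianVector_iff_chartBilin (x₀ : M) {y : E}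
    (hy : y ∈ (extChartAt 𝓘(ℝ, E) x₀).target) (v : E) :
    IsHamiltonianVector σ h ((extChartAt 𝓘(ℝ, E) x₀).symm y)
      (mfderiv 𝓘(ℝ, E) 𝓘(ℝ, E) (extChartAt 𝓘(ℝ, E) x₀).symm y v) ↔
    chartBilin σ x₀ y v = fderiv ℝ (h ∘ (extChartAt 𝓘(ℝ, E) x₀).symm) y := by
  constructor
  · intro H
    ext w
    rw [chartBilin_apply, H, fderiv_comp_extChartAt_symm x₀ hy (mdifferentiableAt_smooth h _)]
  · intro H w
    obtain ⟨w', rfl⟩ := (bijective_mfderiv_extChartAt_symm x₀ hy).2 w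
    refine (chartBilin_apply σ x₀ y v w').symm.trans ?_
    rw [H]
    exact fderiv_comp_extChartAt_symm x₀ hy (mdifferentiableAt_smooth h _) w'

end Chart

/-! ### Tangent spaces of the foliation and existence of Hamiltonian vectors -/

section Transverse

variable {E : Type*} [NormedAddCommGroup E] [NormedSpace ℝ E]
  {M : Type*} [TopologicalSpace M] [ChartedSpace E M] [IsManifold 𝓘(ℝ, E) ∞ M]
  {E' : Type*} [NormedAddCommGroup E'] [NormedSpace ℝ E']
  {N₀ : Type*} [TopologicalSpace N₀] [ChartedSpace E' N₀] [IsManifold 𝓘(ℝ, E') ∞ N₀]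
  {ι : Type*} {F : Foliation E M E' N₀ ι}

namespace Foliation

/-- Since `f_j = g_ji ∘ f_i` on the overlap, `f_j` is constant on the fibres of `f_i` near `x`, so
its differential kills the kernel of that of `f_i`. -/
theorem mem_tangent_iff {i : ι} {x : M} (hx : x ∈ F.U i) (u : TangentSpace 𝓘(ℝ, E) x) :
    u ∈ F.tangent x ↔ mfderiv 𝓘(ℝ, E) 𝓘(ℝ, E') (F.f i) x u = 0 := by
  refine ⟨fun H => H i hx, fun H j hj => ?_⟩
  refine (F.submersion i x hx).mfderiv_apply_eq_zero
    ((F.submersion j x hj).contMDiffAt.mdifferentiableAt (by simp)) ?_ H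
  filter_upwards [(F.isOpen_U i).mem_nhds hx, (F.isOpen_U j).mem_nhds hj] with y hyi hyj hfy
  rw [← F.g_comp j i y ⟨hyj, hyi⟩, ← F.g_comp j i x ⟨hj, hx⟩, hfy]

theorem mfderiv_eq_zero_of_mem_tangent (h : F.basicFunctions) {x : M}
    {u : TangentSpace 𝓘(ℝ, E) x} (hu : u ∈ F.tangent x) :
    mfderiv 𝓘(ℝ, E) 𝓘(ℝ, ℝ) (h : C^∞⟮𝓘(ℝ, E), M; ℝ⟯) x u = 0 := by
  obtain ⟨i, hi⟩ := F.cover x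
  refine (F.submersion i x hi).mfderiv_apply_eq_zero (mdifferentiableAt_smooth h.1 x) ?_
    (hu i hi)
  filter_upwards [(F.isOpen_U i).mem_nhds hi] with y hy hfy
  exact h.2 x y (Relation.EqvGen.rel _ _ ⟨i, hi, hy, hfy.symm⟩)

/-- A differentiable function whose differential vanishes on the tangent spaces of the foliation
is constant on the leaves. -/
theorem eq_of_mem_leaf {k : M → ℝ} (hk : MDifferentiable 𝓘(ℝ, E) 𝓘(ℝ, ℝ) k)
    (hker : ∀ x, ∀ u ∈ F.tangent x, mfderiv 𝓘(ℝ, E) 𝓘(ℝ, ℝ) k x u = 0) {x y : M}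
    (hy : y ∈ F.leaf x) : k y = k x := by
  induction hy with
  | rel a b hab =>
    obtain ⟨i, ha, hb, hf⟩ := hab
    have hpre := F.connected_fibres i (F.f i a)
    let S : Set M := F.U i ∩ F.f i ⁻¹' {F.f i a}
    -- The hypothesis makes `k` locally constant on the plaque `S`; connectedness of the fibre makes
    -- it constant.
    have hloc : ∀ z ∈ S, ∀ᶠ w in 𝓝[S] z, k w = k z := by
      intro z hz
      have := (F.submersion i z hz.1).eventually_eq_of_mfderiv_eq_zero
        (Filter.Eventually.of_forall hk) (by
          filter_upwards [(F.isOpen_U i).mem_nhds hz.1] with w hw u hu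
          exact hker w u ((mem_tangent_iff hw u).2 hu))
      filter_upwards [self_mem_nhdsWithin, nhdsWithin_le_nhds this] with w hw hkw
      exact hkw (hw.2.trans hz.2.symm)
    have : PreconnectedSpace S := Subtype.preconnectedSpace hpre
    have hlc : IsLocallyConstant fun z : S => k z := by
      rw [IsLocallyConstant.iff_eventually_eq]
      intro z
      rw [nhds_subtype_eq_comap_nhdsWithin]
      exact (hloc z z.2).comap _
    exact hlc.apply_eq_of_preconnectedSpace ⟨b, hb, hf.symm⟩ ⟨a, ha, rfl⟩
  | refl a => rfl
  | symm a b _ ih => exact ih.symm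
  | trans a b c _ _ h₁ h₂ => exact h₂.trans h₁

end Foliation

variable {σ : DiffForm E M 2} (hσ : F.IsTransverseSymplectic σ)

namespace Foliation.IsTransverseSymplectic
include hσ

omit [IsManifold 𝓘(ℝ, E) ∞ M] [IsManifold 𝓘(ℝ, E') ∞ N₀] in
theorem mem_tangent_iff {x : M} (u : TangentSpace 𝓘(ℝ, E) x) :
    u ∈ F.tangent x ↔ ∀ w : TangentSpace 𝓘(ℝ, E) x, σ.toFun x ![u, w] = 0 :=
  ⟨fun hu w => (hσ.basic x u hu).1 ![w], hσ.maximalRank x u⟩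

omit [IsManifold 𝓘(ℝ, E') ∞ N₀] in
theorem chartBilin_eq_zero_iff (x₀ : M) {y : E} (hy : y ∈ (extChartAt 𝓘(ℝ, E) x₀).target) (v : E) :
    chartBilin σ x₀ y v = 0 ↔
      mfderiv 𝓘(ℝ, E) 𝓘(ℝ, E) (extChartAt 𝓘(ℝ, E) x₀).symm y v ∈
        F.tangent ((extChartAt 𝓘(ℝ, E) x₀).symm y) := by
  rw [hσ.mem_tangent_iff]
  constructor
  · intro H w
    obtain ⟨w', rfl⟩ := (bijective_mfderiv_extChartAt_symm x₀ hy).2 w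
    refine (chartBilin_apply σ x₀ y v w').symm.trans ?_
    rw [H]
    rfl
  · intro H
    ext w
    rw [chartBilin_apply, H]
    rfl

/-- The kernel is that of the differential of `f_i` read in the chart, which maps onto `E'`. This is
the constant rank needed for smooth local solutions. -/
theorem finrank_ker_chartBilin [FiniteDimensional ℝ E] (x₀ : M) {y : E}
    (hy : y ∈ (extChartAt 𝓘(ℝ, E) x₀).target) :
    Module.finrank ℝ E' + Module.finrank ℝ (chartBilin σ x₀ y).ker = Module.finrank ℝ E := by
  obtain ⟨i, hi⟩ := F.cover ((extChartAt 𝓘(ℝ, E) x₀).symm y)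
  let A : E →ₗ[ℝ] E := (mfderiv 𝓘(ℝ, E) 𝓘(ℝ, E) (extChartAt 𝓘(ℝ, E) x₀).symm y).toLinearMap
  let D : E →ₗ[ℝ] E' :=
    (mfderiv 𝓘(ℝ, E) 𝓘(ℝ, E') (F.f i) ((extChartAt 𝓘(ℝ, E) x₀).symm y)).toLinearMap
  have hsurj : Function.Surjective (D ∘ₗ A) :=
    (F.submersion i _ hi).mfderiv_surjective.comp (bijective_mfderiv_extChartAt_symm x₀ hy).2
  have hker : (D ∘ₗ A).ker = (chartBilin σ x₀ y).ker := by
    ext v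
    rw [LinearMap.mem_ker, LinearMap.mem_ker]
    exact ((hσ.chartBilin_eq_zero_iff x₀ hy v).trans (Foliation.mem_tangent_iff hi _)).symm
  have := LinearMap.finrank_range_add_finrank_ker (D ∘ₗ A)
  rwa [LinearMap.range_eq_top.2 hsurj, finrank_top, hker] at this

/-- Hamiltonian vectors extend to smooth local Hamiltonian vector fields. -/
theorem exists_local_hamiltonian [FiniteDimensional ℝ E] (h : F.basicFunctions) (x₀ : M) {y : E}
    (hy : y ∈ (extChartAt 𝓘(ℝ, E) x₀).target) {u : E}
    (hu : chartBilin σ x₀ y u =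
      fderiv ℝ ((h : C^∞⟮𝓘(ℝ, E), M; ℝ⟯) ∘ (extChartAt 𝓘(ℝ, E) x₀).symm) y) :
    ∃ X : E → E, ContDiffAt ℝ ∞ X y ∧ X y = u ∧ ∀ᶠ z in 𝓝 y, chartBilin σ x₀ z (X z) =
      fderiv ℝ ((h : C^∞⟮𝓘(ℝ, E), M; ℝ⟯) ∘ (extChartAt 𝓘(ℝ, E) x₀).symm) z := by
  have htar := (isOpen_extChartAt_target (I := 𝓘(ℝ, E)) x₀).mem_nhds hy
  refine exists_contDiffAt_apply_eq (contDiffAt_chartBilin σ x₀ hy)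
    ((contDiffAt_comp_extChartAt_symm h.1 x₀ hy).fderiv_right (by simp))
    (chartBilin_skew σ x₀) ?_ ?_ hu
  · filter_upwards [htar] with z hz
    have h1 := hσ.finrank_ker_chartBilin x₀ hy
    have h2 := hσ.finrank_ker_chartBilin x₀ hz
    omega
  · filter_upwards [htar] with z hz v hv
    rw [fderiv_comp_extChartAt_symm x₀ hz (mdifferentiableAt_smooth h.1 _)]
    exact Foliation.mfderiv_eq_zero_of_mem_tangent h ((hσ.chartBilin_eq_zero_iff x₀ hz v).1 hv)

theorem exists_isHamiltonianVector [FiniteDimensional ℝ E] (h : F.basicFunctions) (x : M) :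
    ∃ u, IsHamiltonianVector σ h x u := by
  have hy := mem_extChartAt_target (I := 𝓘(ℝ, E)) x
  obtain ⟨u, hu⟩ := LinearMap.exists_apply_eq_of_skew
    (ContinuousLinearMap.coeLM ℝ ∘ₗ (chartBilin σ x (extChartAt 𝓘(ℝ, E) x x)).toLinearMap)
    (fun v w => chartBilin_skew σ x _ v w)
    (fderiv ℝ ((h : C^∞⟮𝓘(ℝ, E), M; ℝ⟯) ∘ (extChartAt 𝓘(ℝ, E) x).symm)
      (extChartAt 𝓘(ℝ, E) x x)).toLinearMap (fun v hv => by
        rw [ContinuousLinearMap.coe_coe,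
          fderiv_comp_extChartAt_symm x hy (mdifferentiableAt_smooth h.1 _)]
        refine Foliation.mfderiv_eq_zero_of_mem_tangent h
          ((hσ.chartBilin_eq_zero_iff x hy v).1 ?_)
        ext w
        exact congrArg (fun q => q w) hv)
  have hu' := (isHamiltonianVector_iff_chartBilin σ h.1 x hy u).2
    (ContinuousLinearMap.coe_injective hu)
  rw [extChartAt_to_inv] at hu'
  exact ⟨_, hu'⟩

end Foliation.IsTransverseSymplectic

end Transverse

end FoliatedPoisson

end

noncomputable section

namespace FoliatedPoisson

variable {E : Type*} [NormedAddCommGroup E] [NormedSpace ℝ E] [FiniteDimensional ℝ E]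
  {M : Type*} [TopologicalSpace M] [ChartedSpace E M] [IsManifold 𝓘(ℝ, E) ∞ M]
  {E' : Type*} [NormedAddCommGroup E'] [NormedSpace ℝ E']
  {N₀ : Type*} [TopologicalSpace N₀] [ChartedSpace E' N₀] [IsManifold 𝓘(ℝ, E') ∞ N₀]
  {ι : Type*} {F : Foliation E M E' N₀ ι} {σ : DiffForm E M 2}

/-- The derivative of a real function at `x` in the direction `u`, as a real number. -/
def dirDeriv {E : Type*} [NormedAddCommGroup E] [NormedSpace ℝ E] {M : Type*} [TopologicalSpace M]
    [ChartedSpace E M] (k : M → ℝ) (x : M) (u : TangentSpace 𝓘(ℝ, E) x) : ℝ :=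
  mfderiv 𝓘(ℝ, E) 𝓘(ℝ, ℝ) k x u

omit [FiniteDimensional ℝ E] [IsManifold 𝓘(ℝ, E) ∞ M] in
theorem IsHamiltonianVector.apply_eq {h : C^∞⟮𝓘(ℝ, E), M; ℝ⟯} {x : M} {u : TangentSpace 𝓘(ℝ, E) x}
    (hu : IsHamiltonianVector σ h x u) (w : TangentSpace 𝓘(ℝ, E) x) :
    dirDeriv h x w = σ.toFun x ![u, w] :=
  (hu w).symm

omit [FiniteDimensional ℝ E] [IsManifold 𝓘(ℝ, E) ∞ M] in
theorem dirDeriv_const (c : ℝ) (x : M) (u : TangentSpace 𝓘(ℝ, E) x) :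
    dirDeriv (fun _ : M => c) x u = 0 := by
  rw [dirDeriv, mfderiv_const]
  rfl

namespace Foliation

/-! ### Functions on the space of leaf closures -/

section LeafClosures

omit [FiniteDimensional ℝ E] [IsManifold 𝓘(ℝ, E) ∞ M] [IsManifold 𝓘(ℝ, E') ∞ N₀]

variable (F)

theorem basicFunctions_eq_closureBasicFunctions : F.basicFunctions = F.closureBasicFunctions := by
  ext h
  refine ⟨fun H x y hy => ?_, fun H x y hy => H x y (subset_closure hy)⟩
  have hc : IsClosed {z | h z = h x} := isClosed_eq h.contMDiff.continuous continuous_const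
  exact closure_minimal (fun z hz => H x z hz) hc hy

/-- The pull-back of functions on the space of leaf closures. -/
def pullback : F.leafClosureSpaceFunctions →ₐ[ℝ] F.basicFunctions where
  toFun φ := ⟨⟨fun x => (φ : F.LeafClosureSpace → ℝ) (F.proj x), φ.2⟩, fun _ _ hy =>
    congrArg (φ : F.LeafClosureSpace → ℝ)
      (Quotient.sound (F.leafClosureSetoid.symm (Relation.EqvGen.rel _ _ (subset_closure hy))))⟩
  map_one' := rfl
  map_mul' _ _ := rfl
  map_zero' := rfl
  map_add' _ _ := rfl
  commutes' _ := rfl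

theorem pullback_apply (φ : F.leafClosureSpaceFunctions) (x : M) :
    (F.pullback φ : C^∞⟮𝓘(ℝ, E), M; ℝ⟯) x = (φ : F.LeafClosureSpace → ℝ) (F.proj x) :=
  rfl

theorem pullback_bijective : Function.Bijective F.pullback := by
  constructor
  · intro φ ψ h
    apply Subtype.ext
    funext q
    obtain ⟨x, rfl⟩ := Quotient.exists_rep q
    exact congrArg (fun k : F.basicFunctions => (k : C^∞⟮𝓘(ℝ, E), M; ℝ⟯) x) h
  · rintro ⟨h, hh⟩
    have hcl : h ∈ F.closureBasicFunctions := F.basicFunctions_eq_closureBasicFunctions ▸ hh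
    have hq : ∀ x y, F.leafClosureSetoid x y → h x = h y := by
      intro x y hxy
      induction hxy with
      | rel a b hab => exact (hcl a b hab).symm
      | refl a => rfl
      | symm a b _ ih => exact ih.symm
      | trans a b c _ _ h₁ h₂ => exact h₁.trans h₂
    exact ⟨⟨Quotient.lift h hq, h.contMDiff⟩, rfl⟩

end LeafClosures

/-! ### The Poisson bracket of basic functions -/

namespace IsTransverseSymplectic

variable (hσ : F.IsTransverseSymplectic σ)

/-- The function `-dh₂(X_{h₁}) = σ(X_{h₁}, X_{h₂})`. -/
def bracketFun (h₁ h₂ : F.basicFunctions) (x : M) : ℝ :=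
  -dirDeriv (h₂ : C^∞⟮𝓘(ℝ, E), M; ℝ⟯) x
    (hσ.exists_isHamiltonianVector h₁ x).choose

include hσ

/-- Independence of the chosen vector: pairing with `v` any Hamiltonian vector of `h₁` gives
`dh₁(v)`. -/
theorem bracketFun_eq {h₁ h₂ : F.basicFunctions} {x : M} {u v : TangentSpace 𝓘(ℝ, E) x}
    (hu : IsHamiltonianVector σ h₁ x u) (hv : IsHamiltonianVector σ h₂ x v) :
    hσ.bracketFun h₁ h₂ x = σ.toFun x ![u, v] := by
  rw [bracketFun, hv.apply_eq, ← ContinuousAlternatingMap.apply_swap_two, ← hu.apply_eq,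
    (hσ.exists_isHamiltonianVector h₁ x).choose_spec.apply_eq]

theorem bracketFun_antisymm (h₁ h₂ : F.basicFunctions) (x : M) :
    hσ.bracketFun h₁ h₂ x = -hσ.bracketFun h₂ h₁ x := by
  obtain ⟨u, hu⟩ := hσ.exists_isHamiltonianVector h₁ x
  obtain ⟨v, hv⟩ := hσ.exists_isHamiltonianVector h₂ x
  rw [hσ.bracketFun_eq hu hv, hσ.bracketFun_eq hv hu, ContinuousAlternatingMap.apply_swap_two]

/-- In a chart, the Hamiltonian vectors at a point extend to smooth local vector fields. -/
theorem exists_chart_hamiltonian (h : F.basicFunctions) (x₀ : M) {y : E}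
    (hy : y ∈ (extChartAt 𝓘(ℝ, E) x₀).target) :
    ∃ X : E → E, ContDiffAt ℝ ∞ X y ∧ ∀ᶠ z in 𝓝 y, chartBilin σ x₀ z (X z) =
      fderiv ℝ ((h : C^∞⟮𝓘(ℝ, E), M; ℝ⟯) ∘ (extChartAt 𝓘(ℝ, E) x₀).symm) z := by
  obtain ⟨u, hu⟩ := hσ.exists_isHamiltonianVector h ((extChartAt 𝓘(ℝ, E) x₀).symm y)
  obtain ⟨a, rfl⟩ := (bijective_mfderiv_extChartAt_symm x₀ hy).2 u
  obtain ⟨X, hX, -, hXh⟩ := hσ.exists_local_hamiltonian h x₀ hy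
    ((isHamiltonianVector_iff_chartBilin σ h.1 x₀ hy a).1 hu)
  exact ⟨X, hX, hXh⟩

theorem bracketFun_eventuallyEq {h₁ h₂ : F.basicFunctions} (x₀ : M) {y : E}
    (hy : y ∈ (extChartAt 𝓘(ℝ, E) x₀).target) {X Y : E → E}
    (hX : ∀ᶠ z in 𝓝 y, chartBilin σ x₀ z (X z) =
      fderiv ℝ ((h₁ : C^∞⟮𝓘(ℝ, E), M; ℝ⟯) ∘ (extChartAt 𝓘(ℝ, E) x₀).symm) z)
    (hY : ∀ᶠ z in 𝓝 y, chartBilin σ x₀ z (Y z) =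
      fderiv ℝ ((h₂ : C^∞⟮𝓘(ℝ, E), M; ℝ⟯) ∘ (extChartAt 𝓘(ℝ, E) x₀).symm) z) :
    hσ.bracketFun h₁ h₂ ∘ (extChartAt 𝓘(ℝ, E) x₀).symm =ᶠ[𝓝 y]
      fun z => chartBilin σ x₀ z (X z) (Y z) := by
  filter_upwards [hX, hY, (isOpen_extChartAt_target (I := 𝓘(ℝ, E)) x₀).mem_nhds hy]
    with z hXz hYz hz
  rw [Function.comp_apply, chartBilin_apply]
  exact hσ.bracketFun_eq ((isHamiltonianVector_iff_chartBilin σ h₁.1 x₀ hz _).2 hXz)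
    ((isHamiltonianVector_iff_chartBilin σ h₂.1 x₀ hz _).2 hYz)

theorem contMDiff_bracketFun (h₁ h₂ : F.basicFunctions) :
    ContMDiff 𝓘(ℝ, E) 𝓘(ℝ, ℝ) ∞ (hσ.bracketFun h₁ h₂) := by
  intro x
  have hy := mem_extChartAt_target (I := 𝓘(ℝ, E)) x
  obtain ⟨X, hX, hXh⟩ := hσ.exists_chart_hamiltonian h₁ x hy
  obtain ⟨Y, hY, hYh⟩ := hσ.exists_chart_hamiltonian h₂ x hy
  have hloc : ContDiffAt ℝ ∞ (fun z => chartBilin σ x z (X z) (Y z)) (extChartAt 𝓘(ℝ, E) x x) :=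
    ((contDiffAt_chartBilin σ x hy).clm_apply hX).clm_apply hY
  have hcomp := hloc.contMDiffAt.comp x (contMDiffAt_extChartAt (I := 𝓘(ℝ, E)) (n := ∞))
  refine hcomp.congr_of_eventuallyEq ?_
  have hev := hσ.bracketFun_eventuallyEq x hy hXh hYh
  filter_upwards [(continuousAt_extChartAt (I := 𝓘(ℝ, E)) x).eventually hev,
    extChartAt_source_mem_nhds (I := 𝓘(ℝ, E)) x] with z hz hzs
  rw [Function.comp_apply, ← hz, Function.comp_apply, (extChartAt 𝓘(ℝ, E) x).left_inv hzs]

/-- The Jacobi identity at the centre of a preferred chart, for arbitrary Hamiltonian vectors. -/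
theorem cyclic_sum_mfderiv_bracketFun (h₁ h₂ h₃ : F.basicFunctions) (x : M)
    {u v w : TangentSpace 𝓘(ℝ, E) x} (hu : IsHamiltonianVector σ h₁ x u)
    (hv : IsHamiltonianVector σ h₂ x v) (hw : IsHamiltonianVector σ h₃ x w) :
    dirDeriv (hσ.bracketFun h₂ h₃) x u +
      dirDeriv (hσ.bracketFun h₃ h₁) x v +
      dirDeriv (hσ.bracketFun h₁ h₂) x w = 0 := by
  have hy := mem_extChartAt_target (I := 𝓘(ℝ, E)) x
  -- Generalising the base point moves the tangent vectors from `x` to the propositionally equal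
  -- point produced by the chart.
  suffices key : ∀ x', x' = (extChartAt 𝓘(ℝ, E) x).symm (extChartAt 𝓘(ℝ, E) x x) →
      ∀ u v w : TangentSpace 𝓘(ℝ, E) x', IsHamiltonianVector σ h₁ x' u →
      IsHamiltonianVector σ h₂ x' v → IsHamiltonianVector σ h₃ x' w →
      dirDeriv (hσ.bracketFun h₂ h₃) x' u +
      dirDeriv (hσ.bracketFun h₃ h₁) x' v +
      dirDeriv (hσ.bracketFun h₁ h₂) x' w = 0 from
    key x (extChartAt_to_inv x).symm u v w hu hv hw
  rintro _ rfl u v w hu hv hw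
  obtain ⟨a, rfl⟩ := (bijective_mfderiv_extChartAt_symm x hy).2 u
  obtain ⟨b, rfl⟩ := (bijective_mfderiv_extChartAt_symm x hy).2 v
  obtain ⟨c, rfl⟩ := (bijective_mfderiv_extChartAt_symm x hy).2 w
  obtain ⟨X, hX, hXa, hXh⟩ := hσ.exists_local_hamiltonian h₁ x hy
    ((isHamiltonianVector_iff_chartBilin σ h₁.1 x hy a).1 hu)
  obtain ⟨Y, hY, hYb, hYh⟩ := hσ.exists_local_hamiltonian h₂ x hy
    ((isHamiltonianVector_iff_chartBilin σ h₂.1 x hy b).1 hv)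
  obtain ⟨Z, hZ, hZc, hZh⟩ := hσ.exists_local_hamiltonian h₃ x hy
    ((isHamiltonianVector_iff_chartBilin σ h₃.1 x hy c).1 hw)
  have hcd := fun h : F.basicFunctions =>
    (contDiffAt_comp_extChartAt_symm h.1 x hy).of_le (m := 2) (WithTop.coe_le_coe.2 le_top)
  have main := cyclic_sum_fderiv_eq_zero
    ((contDiffAt_chartBilin σ x hy).differentiableAt (by simp)) (chartBilin_skew σ x)
    (hσ.closed.cyclic x) (hcd h₁) (hcd h₂) (hcd h₃) (hX.differentiableAt (by simp))
    (hY.differentiableAt (by simp)) (hZ.differentiableAt (by simp)) hXh hYh hZh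
  rw [← (hσ.bracketFun_eventuallyEq x hy hYh hZh).fderiv_eq,
    ← (hσ.bracketFun_eventuallyEq x hy hZh hXh).fderiv_eq,
    ← (hσ.bracketFun_eventuallyEq x hy hXh hYh).fderiv_eq, hXa, hYb, hZc] at main
  have hd := fun k₁ k₂ : F.basicFunctions =>
    (hσ.contMDiff_bracketFun k₁ k₂).mdifferentiableAt
      (x := (extChartAt 𝓘(ℝ, E) x).symm (extChartAt 𝓘(ℝ, E) x x)) (by simp)
  have e1 := fderiv_comp_extChartAt_symm x hy (hd h₂ h₃) a
  have e2 := fderiv_comp_extChartAt_symm x hy (hd h₃ h₁) b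
  have e3 := fderiv_comp_extChartAt_symm x hy (hd h₁ h₂) c
  rw [e1, e2, e3] at main
  exact main

omit [FiniteDimensional ℝ E] [IsManifold 𝓘(ℝ, E) ∞ M] [IsManifold 𝓘(ℝ, E') ∞ N₀] in
theorem isHamiltonianVector_zero {x : M} {u : TangentSpace 𝓘(ℝ, E) x} (hu : u ∈ F.tangent x) :
    IsHamiltonianVector σ ((0 : F.basicFunctions) : C^∞⟮𝓘(ℝ, E), M; ℝ⟯) x u := by
  intro w
  refine ((hσ.mem_tangent_iff u).1 hu w).trans ?_
  have : ⇑((0 : F.basicFunctions) : C^∞⟮𝓘(ℝ, E), M; ℝ⟯) = fun _ => (0 : ℝ) := rfl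
  exact (this ▸ dirDeriv_const 0 x w : dirDeriv _ x w = 0).symm

theorem bracketFun_zero_right (h : F.basicFunctions) : hσ.bracketFun h 0 = fun _ => 0 := by
  funext x
  have : ⇑((0 : F.basicFunctions) : C^∞⟮𝓘(ℝ, E), M; ℝ⟯) = fun _ => (0 : ℝ) := rfl
  rw [bracketFun, this, dirDeriv_const, neg_zero]

/-- Jacobi for `0, h₁, h₂` with `u` taken as Hamiltonian vector of `0`: the other two terms are
derivatives of brackets with `0`. -/
theorem mfderiv_bracketFun_eq_zero (h₁ h₂ : F.basicFunctions) (x : M) (u : TangentSpace 𝓘(ℝ, E) x)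
    (hu : u ∈ F.tangent x) : dirDeriv (hσ.bracketFun h₁ h₂) x u = 0 := by
  obtain ⟨v, hv⟩ := hσ.exists_isHamiltonianVector h₁ x
  obtain ⟨w, hw⟩ := hσ.exists_isHamiltonianVector h₂ x
  have h := hσ.cyclic_sum_mfderiv_bracketFun 0 h₁ h₂ x (hσ.isHamiltonianVector_zero hu) hv hw
  have h0 : hσ.bracketFun 0 h₁ = fun _ => 0 := by
    funext y
    rw [hσ.bracketFun_antisymm, hσ.bracketFun_zero_right, neg_zero]
  rwa [h0, hσ.bracketFun_zero_right, dirDeriv_const, dirDeriv_const, add_zero, add_zero] at h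

/-- The Poisson bracket of two basic functions. -/
def bracket (h₁ h₂ : F.basicFunctions) : F.basicFunctions :=
  ⟨⟨hσ.bracketFun h₁ h₂, hσ.contMDiff_bracketFun h₁ h₂⟩, fun _ _ hy =>
    Foliation.eq_of_mem_leaf ((hσ.contMDiff_bracketFun h₁ h₂).mdifferentiable (by simp))
      (hσ.mfderiv_bracketFun_eq_zero h₁ h₂) hy⟩

theorem bracket_antisymm (h₁ h₂ : F.basicFunctions) : hσ.bracket h₁ h₂ = -hσ.bracket h₂ h₁ :=
  Subtype.ext (ContMDiffMap.ext fun x => hσ.bracketFun_antisymm h₁ h₂ x)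

/-- The vector chosen in `bracketFun` depends only on the first argument, so additivity, homogeneity
and Leibniz in the second are rules for the differential at a point. The first argument follows by
antisymmetry. -/
theorem bracket_add_right (h k₁ k₂ : F.basicFunctions) :
    hσ.bracket h (k₁ + k₂) = hσ.bracket h k₁ + hσ.bracket h k₂ := by
  refine Subtype.ext (ContMDiffMap.ext fun x => ?_)
  have h1 := ((mdifferentiableAt_smooth k₁.1 x).hasMFDerivAt.add
    (mdifferentiableAt_smooth k₂.1 x).hasMFDerivAt).mfderiv
  have h2 := congrArg (fun T : E →L[ℝ] ℝ => T (hσ.exists_isHamiltonianVector h x).choose) h1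
  exact (congrArg Neg.neg h2).trans (neg_add _ _)

theorem bracket_smul_right (c : ℝ) (h k : F.basicFunctions) :
    hσ.bracket h (c • k) = c • hσ.bracket h k := by
  refine Subtype.ext (ContMDiffMap.ext fun x => ?_)
  have h1 := ((mdifferentiableAt_smooth k.1 x).hasMFDerivAt.const_smul c).mfderiv
  have h2 := congrArg (fun T : E →L[ℝ] ℝ => T (hσ.exists_isHamiltonianVector h x).choose) h1
  exact (congrArg Neg.neg h2).trans (mul_neg _ _).symm

theorem bracket_mul_right (h k₁ k₂ : F.basicFunctions) :
    hσ.bracket h (k₁ * k₂) = hσ.bracket h k₁ * k₂ + k₁ * hσ.bracket h k₂ := by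
  refine Subtype.ext (ContMDiffMap.ext fun x => ?_)
  have h1 := ((mdifferentiableAt_smooth k₁.1 x).hasMFDerivAt.mul
    (mdifferentiableAt_smooth k₂.1 x).hasMFDerivAt).mfderiv
  have h2 := congrArg (fun T : E →L[ℝ] ℝ => T (hσ.exists_isHamiltonianVector h x).choose) h1
  have h3 : ∀ a b c d : ℝ, -(a * b + c * d) = -d * c + a * -b := fun a b c d => by ring
  exact (congrArg Neg.neg h2).trans (h3 _ _ _ _)

theorem bracket_jacobi (h₁ h₂ h₃ : F.basicFunctions) :
    hσ.bracket h₁ (hσ.bracket h₂ h₃) + hσ.bracket h₂ (hσ.bracket h₃ h₁) +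
      hσ.bracket h₃ (hσ.bracket h₁ h₂) = 0 := by
  refine Subtype.ext (ContMDiffMap.ext fun x => ?_)
  have key := hσ.cyclic_sum_mfderiv_bracketFun h₁ h₂ h₃ x
    (hσ.exists_isHamiltonianVector h₁ x).choose_spec
    (hσ.exists_isHamiltonianVector h₂ x).choose_spec
    (hσ.exists_isHamiltonianVector h₃ x).choose_spec
  have h3 : ∀ a b c : ℝ, a + b + c = 0 → -a + -b + -c = 0 := fun a b c h => by linarith
  exact h3 _ _ _ key

/-- The Poisson structure on the basic functions of a transversely symplectic foliation. -/
def poissonStructure : PoissonStructure ℝ F.basicFunctions where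
  bracket := LinearMap.mk₂ ℝ hσ.bracket
    (fun a b c => by
      rw [hσ.bracket_antisymm, hσ.bracket_add_right, hσ.bracket_antisymm a, hσ.bracket_antisymm b,
        neg_add])
    (fun c a b => by
      rw [hσ.bracket_antisymm, hσ.bracket_smul_right, hσ.bracket_antisymm a, smul_neg])
    hσ.bracket_add_right (fun c a b => hσ.bracket_smul_right c a b)
  bracket_self a := Subtype.ext (ContMDiffMap.ext fun x =>
    self_eq_neg.1 (hσ.bracketFun_antisymm a a x))
  jacobi := hσ.bracket_jacobi
  leibniz := hσ.bracket_mul_right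

end IsTransverseSymplectic

end Foliation

end FoliatedPoisson

/-- Transport of a Poisson structure along an isomorphism of algebras. -/
def PoissonStructure.comap {R A B : Type*} [CommRing R] [CommRing A] [Algebra R A] [CommRing B]
    [Algebra R B] (P : PoissonStructure R B) (e : A ≃ₐ[R] B) : PoissonStructure R A where
  bracket := (P.bracket.compl₁₂ e.toLinearMap e.toLinearMap).compr₂ e.symm.toLinearMap
  bracket_self a := by simp [P.bracket_self]
  jacobi a b c := by
    apply e.injective
    simpa using P.jacobi (e a) (e b) (e c)
  leibniz a b c := by
    apply e.injective
    simpa using P.leibniz (e a) (e b) (e c)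

theorem PoissonStructure.map_comap_bracket {R A B : Type*} [CommRing R] [CommRing A] [Algebra R A]
    [CommRing B] [Algebra R B] (P : PoissonStructure R B) (e : A ≃ₐ[R] B) (a b : A) :
    e ((P.comap e).bracket a b) = P.bracket (e a) (e b) :=
  e.apply_symm_apply _

end

open FoliatedPoisson in
theorem mainTheorem1
    {E : Type*} [NormedAddCommGroup E] [NormedSpace ℝ E] [FiniteDimensional ℝ E]
    {M : Type*} [TopologicalSpace M] [ChartedSpace E M] [IsManifold 𝓘(ℝ, E) ∞ M]
    {E' : Type*} [NormedAddCommGroup E'] [NormedSpace ℝ E'] [FiniteDimensional ℝ E']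
    {N₀ : Type*} [TopologicalSpace N₀] [ChartedSpace E' N₀] [IsManifold 𝓘(ℝ, E') ∞ N₀]
    {ι : Type*} (F : Foliation E M E' N₀ ι)
    (σ : DiffForm E M 2) (hσ : F.IsTransverseSymplectic σ) :
    F.basicFunctions = F.closureBasicFunctions ∧
    (∀ (h : F.basicFunctions) (x : M), ∃ u, IsHamiltonianVector σ h x u) ∧
    ∃ (e : F.leafClosureSpaceFunctions ≃ₐ[ℝ] F.basicFunctions)
      (P : PoissonStructure ℝ F.basicFunctions)
      (Q : PoissonStructure ℝ F.leafClosureSpaceFunctions),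
      (∀ (φ : F.leafClosureSpaceFunctions) (x : M),
        (e φ : C^∞⟮𝓘(ℝ, E), M; ℝ⟯) x = (φ : F.LeafClosureSpace → ℝ) (F.proj x)) ∧
      (∀ (h₁ h₂ : F.basicFunctions) (x : M) (u v : TangentSpace 𝓘(ℝ, E) x),
        IsHamiltonianVector σ h₁ x u → IsHamiltonianVector σ h₂ x v →
          (P.bracket h₁ h₂ : C^∞⟮𝓘(ℝ, E), M; ℝ⟯) x = σ.toFun x ![u, v]) ∧
      (∀ φ ψ : F.leafClosureSpaceFunctions, e (Q.bracket φ ψ) = P.bracket (e φ) (e ψ)) := by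
  refine ⟨F.basicFunctions_eq_closureBasicFunctions, hσ.exists_isHamiltonianVector,
    AlgEquiv.ofBijective F.pullback F.pullback_bijective, hσ.poissonStructure,
    hσ.poissonStructure.comap _, F.pullback_apply, fun _ _ _ _ _ => hσ.bracketFun_eq,
    hσ.poissonStructure.map_comap_bracket _⟩
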